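/- Let $n\ge 4$ be an integer and $\varepsilon\in\{+1,-1\}$. Let $\hat Q_3(1,-1,n,\varepsilon)$ be the closure of the three-strand braid $(\sigma_1\sigma_2^{-1})^n(\sigma_1\sigma_2)^{3\varepsilon}$ (a knot exactly when $3\nmid n$). Put $[3]_q=q^2+1+q^{-2}$, $[2]_q=q+q^{-1}$, $[N+j]_q=\dfrac{Aq^{j}-A^{-1}q^{-j}}{q-q^{-1}}$. Define the un-normalized HOMFLY-PT polynomial of the closure of a three-strand braid $\beta$ by $$\mathcal H^*_{[1]}(q,A)=\sum_{\Xi\in\{[3],[1,1,1],[2,1]\}}S^*_\Xi\,\mathrm{Tr}\,\rho_\Xi(\beta),$$ with quantum dimensions $S^*_{[3]}=\frac{[N]_q[N+1]_q[N+2]_q}{[2]_q[3]_q}$, $S^*_{[1,1,1]}=\frac{[N]_q[N-1]_q[N-2]_q}{[2]_q[3]_q}$, $S^*_{[2,1]}=\frac{[N]_q[N+1]_q[N-1]_q}{[3]_q}$, where $\rho_{[3]}(\sigma_i)=q/A$, $\rho_{[1,1,1]}(\sigma_i)=-1/(qA)$ for $i=1,2$, and $\rho_{[2,1]}(\sigma_1)=A^{-1}\mathrm{diag}(q,-q^{-1})$,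 $\rho_{[2,1]}(\sigma_2)=U\rho_{[2,1]}(\sigma_1)U^{T}$ with $U=\frac1{[2]_q}\begin{pmatrix}1&\sqrt{[3]_q}\\-\sqrt{[3]_q}&1\end{pmatrix}$. Then there is a unique family of integers $\hat{\mathbf N}^{\varepsilon}_{[1],m,k}$ ($m,k\in\mathbb Z$, almost all zero), the refined BPS integers of $\hat Q_3(1,-1,n,\varepsilon)$ in the representation $[1]$, with $$\mathcal H^{*}_{[1]}(q,A)=\sum_{m,k}\hat{\mathbf N}^{\varepsilon}_{[1],m,k}\,A^m\,(q-q^{-1})^{2k-1};$$ if $3\nmid n$, only indices $k\ge 0$ occur. For $0\le k\le n$, $$\hat{\mathbf N}^{-1}_{[1],5,k-1}=G_{n,k},\quad \hat{\mathbf N}^{-1}_{[1],7,k-1}=F_{n,k},\quad \hat{\mathbf N}^{+1}_{[1],-5,k-1}=-G_{n,k},\quad \hat{\mathbf N}^{+1}_{[1],-7,k-1}=-F_{n,k},$$ where, with $\delta$ the Kronecker delta and ${}_2F_1$ the hypergeometric function, $$F_{n,k}=\frac{2(-1)^{n-1}}{(2k)!}\prod_{i=0}^{k-1}(n-i)(n+i)\;{}_2F_1\!\left(k-n,\,k+n;\,\tfrac{2k+1}{2};\,\tfrac14\right)-\left(\delta_{k,0}+3\delta_{k,1}+\delta_{k,2}\right),$$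 $$G_{n,k}=\frac{2(-1)^{n}}{(2k)!}\prod_{i=0}^{k-1}(n-i)(n+i)\;{}_2F_1\!\left(k-n,\,k+n;\,\tfrac{2k+1}{2};\,\tfrac14\right)+\left(\delta_{k,0}+6\delta_{k,1}+5\delta_{k,2}+\delta_{k,3}\right).$$ -/

import Mathlib

namespace HybridWeaving

noncomputable section

/-! ### Three-strand braids -/

/-- The braid relation `σ₁ σ₂ σ₁ = σ₂ σ₁ σ₂`, as a set of relators; `σ₁`, `σ₂` are the
generators with index `0`, `1`. -/
def braidRels : Set (FreeGroup (Fin 2)) :=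
  {FreeGroup.of 0 * FreeGroup.of 1 * FreeGroup.of 0 *
    (FreeGroup.of 1 * FreeGroup.of 0 * FreeGroup.of 1)⁻¹}

/-- Artin's braid group on three strands. -/
abbrev Braid3 : Type := PresentedGroup braidRels

/-- The generator `σ₁`. -/
def sigma1 : Braid3 := PresentedGroup.of 0

/-- The generator `σ₂`. -/
def sigma2 : Braid3 := PresentedGroup.of 1

/-- The braid `(σ₁ ^ m₁ σ₂ ^ (-m₂)) ^ n (σ₁ σ₂) ^ (3 ℓ)`, whose closure is the twisted generalized
hybrid weaving knot (or link) with parameters `m₁, -m₂, n, ℓ`. -/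
def Qhat (m₁ m₂ n : ℕ) (l : ℤ) : Braid3 :=
  (sigma1 ^ m₁ * sigma2 ^ (-(m₂ : ℤ))) ^ n * (sigma1 * sigma2) ^ (3 * l)

/-- A pair of elements of a group satisfying the braid relation gives a representation of the
three-strand braid group. -/
def braidRep {G : Type*} [Group G] (a b : G) (h : a * b * a = b * a * b) : Braid3 →* G :=
  PresentedGroup.toGroup (f := ![a, b]) (rels := braidRels) (by
    intro r hr
    rw [braidRels, Set.mem_singleton_iff] at hr
    subst hr
    simpa using mul_inv_eq_one.mpr h)

/-! ### The blocks of the braiding matrices for `[1]⊗[1]⊗[1] = [3] ⊕ [1,1,1] ⊕ 2 [2,1]` -/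

/-- The quantum number `[2]_q`. -/
def two_q (q : ℝ) : ℝ := q + q⁻¹

/-- The quantum number `[3]_q`. -/
def three_q (q : ℝ) : ℝ := q ^ 2 + 1 + q⁻¹ ^ 2

/-- The quantum number `[N + j]_q`, with `q ^ N` replaced by the variable `A`. -/
def shifted_q (q A : ℝ) (j : ℤ) : ℝ := (A * q ^ j - A⁻¹ * q ^ (-j)) / (q - q⁻¹)

/-- The Racah matrix in the multiplicity space of `[2,1]`. -/
def racah (q : ℝ) : Matrix (Fin 2) (Fin 2) ℝ :=
  !![1 / two_q q, √(three_q q) / two_q q; -(√(three_q q) / two_q q), 1 / two_q q]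

/-- The braiding matrix of `σ₁` in the multiplicity space of `[2,1]`. -/
def R1 (q A : ℝ) : Matrix (Fin 2) (Fin 2) ℝ := !![q / A, 0; 0, -(1 / (A * q))]

/-- The braiding matrix of `σ₂` in the multiplicity space of `[2,1]`. -/
def R2 (q A : ℝ) : Matrix (Fin 2) (Fin 2) ℝ := racah q * R1 q A * (racah q).transpose

theorem two_q_ne_zero {q : ℝ} (hq : 0 < q) : two_q q ≠ 0 := by
  unfold two_q; positivity

theorem det_R1_ne_zero {q A : ℝ} (hq : 0 < q) (hA : A ≠ 0) : (R1 q A).det ≠ 0 := by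
  have := hq.ne'
  simp [R1, Matrix.det_fin_two, hA, this]

theorem det_racah {q : ℝ} (hq : 0 < q) : (racah q).det = 1 := by
  have h2 := two_q_ne_zero hq
  have h3 : √(three_q q) ^ 2 = three_q q := Real.sq_sqrt (by unfold three_q; positivity)
  have : (racah q).det = (1 + √(three_q q) ^ 2) / two_q q ^ 2 := by
    simp only [racah, Matrix.det_fin_two_of]; field_simp; ring
  rw [this, h3, div_eq_one_iff_eq (pow_ne_zero 2 h2)]
  unfold two_q three_q
  field_simp
  ring

theorem det_R2_ne_zero {q A : ℝ} (hq : 0 < q) (hA : A ≠ 0) : (R2 q A).det ≠ 0 := by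
  rw [R2, Matrix.det_mul, Matrix.det_mul, Matrix.det_transpose, det_racah hq]
  simpa using det_R1_ne_zero hq hA

theorem R2_eq {q A : ℝ} (hq : 0 < q) (hA : A ≠ 0) :
    R2 q A = !![-(q⁻¹ ^ 2 / (A * two_q q)), -(√(three_q q) / (A * two_q q));
      -(√(three_q q) / (A * two_q q)), q ^ 2 / (A * two_q q)] := by
  have h2 := two_q_ne_zero hq
  have hq' := hq.ne'
  have h3 : √(three_q q) ^ 2 = three_q q := Real.sq_sqrt (by unfold three_q; positivity)
  have h5 : q ^ 2 + 1 ≠ 0 := by positivity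
  ext i j
  fin_cases i <;> fin_cases j <;>
    simp [R2, racah, R1, Matrix.mul_apply, Fin.sum_univ_two] <;>
    field_simp <;> (try rw [h3]) <;> unfold two_q <;> (try unfold three_q) <;> field_simp <;> ring

theorem R_braid {q A : ℝ} (hq : 0 < q) (hA : A ≠ 0) :
    R1 q A * R2 q A * R1 q A = R2 q A * R1 q A * R2 q A := by
  have hq' := hq.ne'
  have h3 : √(three_q q) ^ 2 = three_q q := Real.sq_sqrt (by unfold three_q; positivity)
  have h5 : q ^ 2 + 1 ≠ 0 := by positivity
  rw [R2_eq hq hA]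
  generalize √(three_q q) = s at h3
  unfold three_q at h3
  unfold two_q
  field_simp at h3
  ext i j
  fin_cases i <;> fin_cases j <;>
    simp [R1, Matrix.mul_apply, Fin.sum_univ_two] <;>
    field_simp
  all_goals first
    | linear_combination h3
    | linear_combination -h3
    | ring1

/-- The action of three-strand braids on the multiplicity space of `[3]`: both generators act by
`q / A`. -/
def rep3 (q A : ℝ) (hq : 0 < q) (hA : A ≠ 0) : Braid3 →* ℝˣ :=
  braidRep (Units.mk0 (q / A) (div_ne_zero hq.ne' hA)) (Units.mk0 (q / A) (div_ne_zero hq.ne' hA))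
    rfl

/-- The action of three-strand braids on the multiplicity space of `[1,1,1]`: both generators act
by `-1 / (q A)`. -/
def rep111 (q A : ℝ) (hq : 0 < q) (hA : A ≠ 0) : Braid3 →* ℝˣ :=
  braidRep (Units.mk0 (-(1 / (A * q))) (by have := hq.ne'; simp [hA, this]))
    (Units.mk0 (-(1 / (A * q))) (by have := hq.ne'; simp [hA, this])) rfl

/-- The action of three-strand braids on the two-dimensional multiplicity space of `[2,1]`. -/
def rep21 (q A : ℝ) (hq : 0 < q) (hA : A ≠ 0) : Braid3 →* GL (Fin 2) ℝ :=
  braidRep (Matrix.GeneralLinearGroup.mkOfDetNeZero (R1 q A) (det_R1_ne_zero hq hA))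
    (Matrix.GeneralLinearGroup.mkOfDetNeZero (R2 q A) (det_R2_ne_zero hq hA))
    (Units.ext (R_braid hq hA))

/-! ### Quantum dimensions and the HOMFLY-PT polynomial -/

/-- The quantum dimension of `[3]`. -/
def S3 (q A : ℝ) : ℝ :=
  shifted_q q A 0 * shifted_q q A 1 * shifted_q q A 2 / (two_q q * three_q q)

/-- The quantum dimension of `[1,1,1]`. -/
def S111 (q A : ℝ) : ℝ :=
  shifted_q q A 0 * shifted_q q A (-1) * shifted_q q A (-2) / (two_q q * three_q q)

/-- The quantum dimension of `[2,1]`. -/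
def S21 (q A : ℝ) : ℝ :=
  shifted_q q A 0 * shifted_q q A 1 * shifted_q q A (-1) / three_q q

/-- The un-normalized HOMFLY-PT polynomial `H*_[1]` (the unknot has the value `[N]_q`, that is
`(A - A⁻¹) / (q - q⁻¹)`) of the closure of a three-strand braid: the sum over the irreducible
components of `[1]⊗[1]⊗[1]` of the quantum dimension times the trace of the braid on the
multiplicity space. -/
def homflyStar (b : Braid3) (q A : ℝ) (hq : 0 < q) (hA : A ≠ 0) : ℝ :=
  S3 q A * (rep3 q A hq hA b : ℝ) + S111 q A * (rep111 q A hq hA b : ℝ) +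
    S21 q A * Matrix.trace (rep21 q A hq hA b : Matrix (Fin 2) (Fin 2) ℝ)

/-! ### Refined BPS integers in the fundamental representation -/

/-- The reformulated invariant `f_[1]`, which is the un-normalized polynomial `H*_[1]`. -/
def reformulated (b : Braid3) (q A : ℝ) (hq : 0 < q) (hA : A ≠ 0) : ℝ :=
  homflyStar b q A hq hA

/-- The coefficient `C_{[1][1]}`, that is
`(q - q⁻¹)⁻¹ * ∑_Δ z_Δ⁻¹ ψ_[1](Δ) ψ_[1](Δ) ∏_i (q ^ ξ_i - q ^ (-ξ_i))`: the only `Δ` is the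
partition with one part `1`, with `z_Δ = 1` and both characters equal to `1`. -/
def cBox (q : ℝ) : ℝ := (q - q⁻¹)⁻¹ * ((1 : ℝ)⁻¹ * 1 * 1 * (q - q⁻¹))

/-- `N` is the family of refined integers of the closure of `b` in the representation `[1]`:
`N (m, k)` are integers, almost all zero, with
`f_[1] = ∑ C_{[1][1]} N (m, k) A ^ m (q - q⁻¹) ^ (2 k - 1)` identically in `q` and `A`. For a knot
only `k ≥ 0` can occur; the index `k` ranges over all integers to admit links with several
components as well. -/
def IsRefinedFamily (b : Braid3) (N : ℤ × ℤ →₀ ℤ) : Prop :=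
  ∀ (q A : ℝ) (hq : 0 < q) (hA : A ≠ 0), q ≠ 1 →
    reformulated b q A hq hA =
      N.sum fun p c => cBox q * (c : ℝ) * A ^ p.1 * (q - q⁻¹) ^ (2 * p.2 - 1)

/-! ### The closed formulas -/

/-- The common main term
`2 / (2k)! * ∏_{i<k} (n - i) (n + i) * ₂F₁(k - n, k + n; (2k+1)/2; 1/4)`. -/
def mainTerm (n k : ℕ) : ℝ :=
  2 / ((2 * k).factorial : ℝ) * (∏ i ∈ Finset.range k, ((n : ℝ) - i) * ((n : ℝ) + i)) *
    ordinaryHypergeometric ((k : ℝ) - n) ((k : ℝ) + n) ((2 * (k : ℝ) + 1) / 2) (1 / 4 : ℝ)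

/-- The Kronecker delta. -/
def delta (i j : ℕ) : ℝ := if i = j then 1 else 0

/-- The numbers `F_{n,k}`. -/
def F (n k : ℕ) : ℝ :=
  (-1) ^ (n - 1) * mainTerm n k - (delta k 0 + 3 * delta k 1 + delta k 2)

/-- The numbers `G_{n,k}`. -/
def G (n k : ℕ) : ℝ :=
  (-1) ^ n * mainTerm n k + (delta k 0 + 6 * delta k 1 + 5 * delta k 2 + delta k 3)

end

end HybridWeaving

/-!
The braid is `(σ₁ σ₂⁻¹) ^ n` times a power of the full twist `(σ₁ σ₂) ^ 3`. On `[3]` and `[1,1,1]`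
it acts by scalars which do not depend on `n`. On `[2,1]` the full twist is the scalar `A⁻⁶`, by
Cayley-Hamilton for `σ₁ σ₂`, whose determinant is the square of its trace; and `σ₁ σ₂⁻¹` has
determinant `1` and trace `-1 - w` with `w = (q - q⁻¹) ^ 2`, so that the trace of its `n`-th power
is `C_n (-1 - w)` for the Chebyshev polynomial `C_n (x + x⁻¹) = x ^ n + x⁻¹ ^ n`.

As `[3]_q = w + 3` and `C_n 2 = 2`, the denominators `[3]_q` cancel, and for the negative twist
`(q - q⁻¹) ^ 3` times the coefficients of `A ^ 5` and `A ^ 7` are `± C_n (-1 - w)` plus explicit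
polynomials of degree at most `3` in `w`. The Taylor coefficients of `C_n` at `2` are products of
factors `(n - i) (n + i)`; re-expanding at `1` turns them into the values of `₂F₁` at `1 / 4`. The
positive twist follows by the mirror symmetry `(q, A) ↦ (q⁻¹, A⁻¹)`, uniqueness from the linear
independence of the characters `(A, z) ↦ A ^ m z ^ (2 k - 1)`, and the absence of `k < 0` for
`3 ∤ n` from `C_n (-1) = -1`.
-/

namespace HybridWeaving

open Polynomial

/-! ### Chebyshev polynomials and the hypergeometric sum -/

theorem tsum_choose_mul_coeff_mul_pow {R : Type*} [CommSemiring R] [TopologicalSpace R] (p : R[X])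
    (r : R) (k : ℕ) :
    ∑' s, ((s + k).choose k : R) * p.coeff (s + k) * r ^ s = (taylor r p).coeff k := by
  rw [taylor_coeff, eval_eq_sum, Polynomial.sum, tsum_eq_sum (s := (hasseDeriv k p).support)]
  · simp only [hasseDeriv_coeff]
  · intro s hs
    rw [← hasseDeriv_coeff, notMem_support_iff.1 hs, zero_mul]

section Chebyshev

theorem coeff_taylor_two_chebyshevC_mul {R : Type*} [CommRing R] (n : ℤ) (j : ℕ) :
    (taylor 2 (Chebyshev.C R n)).coeff j * (2 ^ j * j.factorial) =
      2 * (derivative^[j] (Chebyshev.T R n)).eval 1 := by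
  have hcomp : (taylor 2 (Chebyshev.C R n)).comp (C 2 * X) = C 2 * taylor 1 (Chebyshev.T R n) := by
    calc _ = taylor 1 ((Chebyshev.C R n).comp (2 * X)) := by
          rw [taylor_apply, taylor_apply, comp_assoc, comp_assoc]
          congr 1
          simp only [add_comp, mul_comp, X_comp, ofNat_comp, map_ofNat, map_one]
          ring
      _ = _ := by rw [Chebyshev.C_comp_two_mul_X, taylor_mul, ← map_ofNat C 2, taylor_C]
  have hcoeff := congrArg (coeff · j) hcomp
  rw [comp_C_mul_X_coeff, coeff_C_mul, taylor_coeff 1] at hcoeff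
  rw [← factorial_smul_hasseDeriv, LinearMap.smul_apply, eval_smul, nsmul_eq_mul]
  linear_combination (j.factorial : R) * hcoeff

variable {K : Type*} [Field K] [CharZero K] (n : ℤ)

theorem coeff_succ_taylor_two_chebyshevC (j : ℕ) :
    (taylor 2 (Chebyshev.C K n)).coeff (j + 1) =
      (n - j) * (n + j) / ((2 * j + 1) * (2 * j + 2)) * (taylor 2 (Chebyshev.C K n)).coeff j := by
  have hfac : (2 : K) ^ j * j.factorial ≠ 0 := by
    exact_mod_cast (by positivity : 2 ^ j * j.factorial ≠ 0)
  have hden : ((2 * j + 1) * (2 * j + 2) : K) ≠ 0 := by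
    exact_mod_cast (by positivity : (2 * j + 1) * (2 * j + 2) ≠ 0)
  have hj := coeff_taylor_two_chebyshevC_mul (R := K) n j
  have hj' := coeff_taylor_two_chebyshevC_mul (R := K) n (j + 1)
  have hT := Chebyshev.iterate_derivative_T_eval_one_recurrence (R := K) n j
  rw [Nat.factorial_succ, pow_succ] at hj'
  push_cast at hj'
  rw [div_mul_eq_mul_div, eq_div_iff hden]
  apply mul_right_cancel₀ hfac
  linear_combination (2 * (j : K) + 1) * hj' - ((n : K) ^ 2 - j ^ 2) * hj + 2 * hT

theorem coeff_taylor_two_chebyshevC (k : ℕ) :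
    (taylor 2 (Chebyshev.C K n)).coeff k =
      2 / (2 * k).factorial * ∏ i ∈ Finset.range k, ((n : K) - i) * (n + i) := by
  induction k with
  | zero => simp [taylor_coeff_zero]
  | succ k ih =>
    have hodd : (2 * k + 1 : K) ≠ 0 := by exact_mod_cast (2 * k).succ_ne_zero
    have heven : (2 * k + 1 + 1 : K) ≠ 0 := by exact_mod_cast (2 * k + 1).succ_ne_zero
    rw [coeff_succ_taylor_two_chebyshevC, ih, Finset.prod_range_succ,
      show 2 * (k + 1) = 2 * k + 1 + 1 by ring, Nat.factorial_succ, Nat.factorial_succ]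
    push_cast
    rw [show (2 * k + 2 : K) = 2 * k + 1 + 1 by ring]
    field_simp [hodd, heven]

theorem ordinaryHypergeometricCoefficient_succ (a b c : K) (s : ℕ) :
    ordinaryHypergeometricCoefficient a b c (s + 1) =
      (a + s) * (b + s) / ((s + 1) * (c + s)) * ordinaryHypergeometricCoefficient a b c s := by
  simp only [ordinaryHypergeometricCoefficient, ascPochhammer_succ_eval, Nat.factorial_succ,
    Nat.cast_mul, Nat.cast_succ, mul_inv, div_eq_mul_inv]
  ring

theorem coeff_taylor_two_chebyshevC_mul_hypergeometric (k s : ℕ) :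
    (taylor 2 (Chebyshev.C K n)).coeff k *
        (ordinaryHypergeometricCoefficient ((k : K) - n) (k + n) ((2 * k + 1) / 2) s *
          (1 / 4) ^ s) =
      (s + k).choose k * (taylor 2 (Chebyshev.C K n)).coeff (s + k) * (-1) ^ s := by
  induction s with
  | zero => simp [ordinaryHypergeometricCoefficient]
  | succ s ih =>
    have hs : (s + 1 : K) ≠ 0 := by exact_mod_cast s.succ_ne_zero
    have hodd : (2 * (s + k) + 1 : K) ≠ 0 := by exact_mod_cast (2 * (s + k)).succ_ne_zero
    have hsk : (s + k + 1 : K) ≠ 0 := by exact_mod_cast (s + k).succ_ne_zero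
    have hchoose : ((s + 1 + k).choose k : K) = (s + k + 1) / (s + 1) * (s + k).choose k := by
      have := Nat.choose_mul_succ_eq (s + k) k
      rw [show s + k + 1 - k = s + 1 by lia, show s + k + 1 = s + 1 + k by ring] at this
      rw [div_mul_eq_mul_div, eq_div_iff hs]
      exact_mod_cast (this.symm.trans (mul_comm _ _)).trans (by ring)
    calc _ = ((k - n + s) * (k + n + s) / ((s + 1) * ((2 * k + 1) / 2 + s)) / 4) *
          ((taylor 2 (Chebyshev.C K n)).coeff k *
            (ordinaryHypergeometricCoefficient ((k : K) - n) (k + n) ((2 * k + 1) / 2) s *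
              (1 / 4) ^ s)) := by
          rw [ordinaryHypergeometricCoefficient_succ]; ring
      _ = _ := by
          rw [ih, hchoose, show s + 1 + k = s + k + 1 by ring, coeff_succ_taylor_two_chebyshevC]
          push_cast
          rw [show ((2 * k + 1) / 2 + s : K) = (2 * (s + k) + 1) / 2 by ring,
            show (2 * (s + k) + 2 : K) = 2 * (s + k + 1) by ring]
          field_simp
          ring

end Chebyshev

theorem mainTerm_eq_coeff (n k : ℕ) :
    mainTerm n k = (taylor 1 (Chebyshev.C ℝ n)).coeff k := by
  calc mainTerm n k
      = (taylor 2 (Chebyshev.C ℝ n)).coeff k *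
          ∑' s, ordinaryHypergeometricCoefficient ((k : ℝ) - n) (k + n) ((2 * k + 1) / 2) s *
            (1 / 4) ^ s := by
        simp only [mainTerm, ordinaryHypergeometric_eq_tsum, coeff_taylor_two_chebyshevC,
          Int.cast_natCast, smul_eq_mul]
    _ = ∑' s, ((s + k).choose k : ℝ) * (taylor 2 (Chebyshev.C ℝ n)).coeff (s + k) * (-1) ^ s := by
        simp only [← tsum_mul_left, ← coeff_taylor_two_chebyshevC_mul_hypergeometric,
          Int.cast_natCast]
    _ = (taylor 1 (Chebyshev.C ℝ n)).coeff k := by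
        rw [tsum_choose_mul_coeff_mul_pow, taylor_taylor]
        norm_num

theorem chebyshevC_comp_neg_X {R : Type*} [CommRing R] (n : ℕ) :
    (Chebyshev.C R n).comp (-X) = (-1) ^ n * Chebyshev.C R n := by
  induction n using Nat.twoStepInduction with
  | zero => simp
  | one => simp
  | more n ih ih' =>
    push_cast at ih' ⊢
    rw [Chebyshev.C_add_two, sub_comp, mul_comp, X_comp, ih, ih']
    ring

/-- The polynomial `C_n (-1 - w)` in `w = (q - q⁻¹) ^ 2`, where `C_n (x + x⁻¹) = x ^ n + x⁻¹ ^ n`: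
the trace of the `n`-th power of a matrix in `SL₂` with trace `-1 - w`. -/
noncomputable def tracePoly (n : ℕ) : ℤ[X] := (Chebyshev.C ℤ n).comp (-1 - X)

theorem aeval_tracePoly {R : Type*} [CommRing R] (w : R) (n : ℕ) :
    aeval w (tracePoly n) = (Chebyshev.C R n).eval (-1 - w) := by
  rw [tracePoly, aeval_comp, Chebyshev.aeval_C]
  simp

theorem map_tracePoly {R : Type*} [CommRing R] (n : ℕ) :
    (tracePoly n).map (Int.castRingHom R) = (-1) ^ n * taylor 1 (Chebyshev.C R n) := by
  have h : (-1 - X : R[X]) = (-X : R[X]).comp (X + C 1) := by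
    simp only [map_one, neg_comp, X_comp]
    ring
  rw [tracePoly, map_comp, Chebyshev.map_C, Polynomial.map_sub, Polynomial.map_neg,
    Polynomial.map_one, map_X, h, ← comp_assoc, chebyshevC_comp_neg_X, taylor_apply, mul_comp]
  simp

theorem coeff_tracePoly (n k : ℕ) :
    ((tracePoly n).coeff k : ℝ) = (-1) ^ n * mainTerm n k := by
  have h := congrArg (coeff · k) (map_tracePoly (R := ℝ) n)
  rw [← C_1, ← C_neg, ← C_pow, coeff_C_mul, coeff_map, ← mainTerm_eq_coeff] at h
  exact h

theorem eval_neg_three_tracePoly (n : ℕ) : (tracePoly n).eval (-3) = 2 := by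
  simp [tracePoly]

theorem eval_neg_one_chebyshevC_of_not_dvd {R : Type*} [CommRing R] {n : ℕ} (hn : ¬ 3 ∣ n) :
    (Chebyshev.C R n).eval (-1) = -1 := by
  have hperiodic : Function.Periodic (fun m : ℕ => (Chebyshev.C R m).eval (-1)) 3 := fun m => by
    have h := Chebyshev.C_add_two R (m + 1)
    rw [show (m + 1 + 1 : ℤ) = m + 2 by ring, show (m + 1 + 2 : ℤ) = m + 3 by ring,
      Chebyshev.C_add_two] at h
    simp [h]
  rw [← hperiodic.map_mod_nat n]
  obtain h | h : n % 3 = 1 ∨ n % 3 = 2 := by lia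
  · simp [h]
  · norm_num [h, Chebyshev.C_two]

theorem coeff_zero_tracePoly_of_not_dvd {n : ℕ} (hn : ¬ 3 ∣ n) : (tracePoly n).coeff 0 = -1 := by
  simp [coeff_zero_eq_eval_zero, tracePoly, eval_neg_one_chebyshevC_of_not_dvd hn]

/-! ### The HOMFLY-PT polynomial -/

section Matrix

variable {R : Type*} [CommRing R] (M : Matrix (Fin 2) (Fin 2) R)

theorem sq_eq_trace_smul_sub_det_smul_one : M ^ 2 = M.trace • M - M.det • 1 := by
  nontriviality R
  have h := M.aeval_self_charpoly
  rw [M.charpoly_fin_two] at h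
  simp only [map_add, map_sub, map_mul, map_pow, aeval_X, aeval_C, Algebra.algebraMap_eq_smul_one,
    smul_mul_assoc, one_mul] at h
  rw [← sub_eq_zero, ← h]
  abel

theorem pow_three_of_det_eq_trace_sq (hM : M.det = M.trace ^ 2) : M ^ 3 = -M.trace ^ 3 • 1 := by
  have h := sq_eq_trace_smul_sub_det_smul_one M
  rw [pow_succ, h, sub_mul, smul_mul_assoc, ← pow_two, h, hM]
  simp only [smul_mul_assoc, one_mul, smul_sub, smul_smul]
  module

theorem trace_pow_of_det_eq_one (hM : M.det = 1) (n : ℕ) :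
    (M ^ n).trace = (Chebyshev.C R n).eval M.trace := by
  induction n using Nat.twoStepInduction with
  | zero => simp
  | one => simp
  | more n ih ih' =>
    have hpow : M ^ (n + 2) = M.trace • M ^ (n + 1) - M ^ n := by
      rw [pow_add, sq_eq_trace_smul_sub_det_smul_one, hM, one_smul, mul_sub, mul_smul_comm, mul_one,
        pow_succ]
    push_cast at ih' ⊢
    rw [hpow, Matrix.trace_sub, Matrix.trace_smul, ih, ih', Chebyshev.C_add_two]
    simp

end Matrix

section BraidRep

variable {G : Type*} [Group G] (a b : G) (h : a * b * a = b * a * b)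

theorem braidRep_sigma1 : braidRep a b h sigma1 = a := by
  simp [braidRep, sigma1]

theorem braidRep_sigma2 : braidRep a b h sigma2 = b := by
  simp [braidRep, sigma2]

theorem braidRep_Qhat (m₁ m₂ n : ℕ) (l : ℤ) :
    braidRep a b h (Qhat m₁ m₂ n l) = (a ^ m₁ * (b ^ m₂)⁻¹) ^ n * ((a * b) ^ 3) ^ l := by
  simp only [Qhat, map_mul, map_pow, map_zpow, map_inv, braidRep_sigma1, braidRep_sigma2,
    zpow_mul, zpow_neg, zpow_natCast, zpow_ofNat]

theorem braidRep_self_Qhat (m n : ℕ) (l : ℤ) :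
    braidRep a a rfl (Qhat m m n l) = (a ^ 6) ^ l := by
  rw [braidRep_Qhat, mul_inv_cancel, one_pow, one_mul, ← pow_two, ← pow_mul]

end BraidRep

section Homfly

variable {q A : ℝ}

theorem det_R1 (hq : q ≠ 0) : (R1 q A).det = -(A ^ 2)⁻¹ := by
  rw [R1, Matrix.det_fin_two_of]
  field_simp
  ring

theorem det_R2 (hq : 0 < q) : (R2 q A).det = -(A ^ 2)⁻¹ := by
  rw [R2, Matrix.det_mul, Matrix.det_mul, Matrix.det_transpose, det_racah hq, det_R1 hq.ne']
  ring

theorem trace_R1_mul_R2 (hq : 0 < q) (hA : A ≠ 0) : (R1 q A * R2 q A).trace = -(A ^ 2)⁻¹ := by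
  rw [R1, R2_eq hq hA, two_q, Matrix.mul_fin_two, Matrix.trace_fin_two_of]
  field_simp
  ring

theorem R1_mul_R2_pow_three (hq : 0 < q) (hA : A ≠ 0) :
    (R1 q A * R2 q A) ^ 3 = (A ^ 6)⁻¹ • (1 : Matrix (Fin 2) (Fin 2) ℝ) := by
  have htrace := trace_R1_mul_R2 hq hA
  rw [pow_three_of_det_eq_trace_sq, htrace]
  · congr 1
    ring
  · rw [htrace, Matrix.det_mul, det_R1 hq.ne', det_R2 hq]
    ring

theorem det_R1_mul_R2_inv (hq : 0 < q) (hA : A ≠ 0) : (R1 q A * (R2 q A)⁻¹).det = 1 := by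
  rw [Matrix.det_mul, Matrix.det_nonsing_inv, det_R1 hq.ne', det_R2 hq, Ring.inverse_eq_inv']
  exact mul_inv_cancel₀ (by simpa using hA)

theorem trace_R1_mul_R2_inv (hq : 0 < q) (hA : A ≠ 0) :
    (R1 q A * (R2 q A)⁻¹).trace = -1 - (q - q⁻¹) ^ 2 := by
  rw [Matrix.inv_def, det_R2 hq, R1, R2_eq hq hA, two_q, Matrix.adjugate_fin_two_of,
    Matrix.mul_smul, Matrix.mul_fin_two, Matrix.trace_smul, Matrix.trace_fin_two_of,
    Ring.inverse_eq_inv', smul_eq_mul]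
  field_simp
  ring

theorem rep3_Qhat (hq : 0 < q) (hA : A ≠ 0) (m n : ℕ) (l : ℤ) :
    (rep3 q A hq hA (Qhat m m n l) : ℝ) = ((q / A) ^ 6) ^ l := by
  simp [rep3, braidRep_self_Qhat]

theorem rep111_Qhat (hq : 0 < q) (hA : A ≠ 0) (m n : ℕ) (l : ℤ) :
    (rep111 q A hq hA (Qhat m m n l) : ℝ) = ((A * q) ^ 6)⁻¹ ^ l := by
  rw [rep111, braidRep_self_Qhat, Units.val_zpow_eq_zpow_val, Units.val_pow_eq_pow_val,
    Units.val_mk0]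
  congr 1
  ring

theorem trace_rep21_Qhat (hq : 0 < q) (hA : A ≠ 0) (n : ℕ) (l : ℤ) :
    Matrix.trace (rep21 q A hq hA (Qhat 1 1 n l) : Matrix (Fin 2) (Fin 2) ℝ) =
      (A ^ 6)⁻¹ ^ l * (Chebyshev.C ℝ n).eval (-1 - (q - q⁻¹) ^ 2) := by
  have hA6 : (A ^ 6)⁻¹ ≠ 0 := by positivity
  have hcentral : (Matrix.GeneralLinearGroup.mkOfDetNeZero (R1 q A) (det_R1_ne_zero hq hA) *
      Matrix.GeneralLinearGroup.mkOfDetNeZero (R2 q A) (det_R2_ne_zero hq hA)) ^ 3 =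
      Units.map (algebraMap ℝ (Matrix (Fin 2) (Fin 2) ℝ) : ℝ →* _) (Units.mk0 _ hA6) := by
    apply Units.ext
    simpa [Algebra.algebraMap_eq_smul_one] using R1_mul_R2_pow_three hq hA
  rw [rep21, braidRep_Qhat, hcentral, pow_one, pow_one, ← map_zpow, Units.val_mul, Units.coe_map,
    Units.val_zpow_eq_zpow_val, Units.val_mk0, ← trace_R1_mul_R2_inv hq hA,
    ← trace_pow_of_det_eq_one _ (det_R1_mul_R2_inv hq hA)]
  simp [Algebra.algebraMap_eq_smul_one]

theorem homflyStar_Qhat (hq : 0 < q) (hA : A ≠ 0) (n : ℕ) (l : ℤ) :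
    homflyStar (Qhat 1 1 n l) q A hq hA =
      S3 q A * ((q / A) ^ 6) ^ l + S111 q A * ((A * q) ^ 6)⁻¹ ^ l +
        S21 q A * ((A ^ 6)⁻¹ ^ l * (Chebyshev.C ℝ n).eval (-1 - (q - q⁻¹) ^ 2)) := by
  rw [homflyStar, rep3_Qhat, rep111_Qhat, trace_rep21_Qhat]

theorem shifted_q_inv (q A : ℝ) (j : ℤ) : shifted_q q⁻¹ A⁻¹ j = shifted_q q A j := by
  rw [shifted_q, shifted_q, ← neg_div_neg_eq, neg_sub, neg_sub]
  simp [inv_zpow']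

theorem two_q_inv (q : ℝ) : two_q q⁻¹ = two_q q := by
  simp [two_q, add_comm]

theorem three_q_inv (q : ℝ) : three_q q⁻¹ = three_q q := by
  simp only [three_q, inv_inv]
  ring

theorem homflyStar_Qhat_neg (hq : 0 < q) (hA : A ≠ 0) (n : ℕ) (l : ℤ) :
    homflyStar (Qhat 1 1 n (-l)) q A hq hA =
      homflyStar (Qhat 1 1 n l) q⁻¹ A⁻¹ (inv_pos.2 hq) (inv_ne_zero hA) := by
  have h3 : (q⁻¹ / A⁻¹) ^ 6 = ((q / A) ^ 6)⁻¹ := by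
    rw [inv_div_inv, ← inv_pow, inv_div]
  have h111 : (A⁻¹ * q⁻¹) ^ 6 = ((A * q) ^ 6)⁻¹ := by rw [← mul_inv, inv_pow]
  have hw : (q⁻¹ - q) ^ 2 = (q - q⁻¹) ^ 2 := by ring
  simp only [homflyStar_Qhat, S3, S111, S21, shifted_q_inv, two_q_inv, three_q_inv, hw, h3, h111,
    inv_pow, zpow_neg, inv_zpow, inv_inv]

theorem three_q_eq (hq : q ≠ 0) : three_q q = (q - q⁻¹) ^ 2 + 3 := by
  rw [three_q]
  field_simp
  ring

theorem S21_eq (hq : q ≠ 0) (hA : A ≠ 0) :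
    S21 q A = (A - A⁻¹) * (A ^ 2 - ((q - q⁻¹) ^ 2 + 2) + (A ^ 2)⁻¹) /
      ((q - q⁻¹) ^ 3 * three_q q) := by
  rw [S21]
  simp only [shifted_q, div_mul_div_comm, div_div]
  congr 1
  · simp only [zpow_neg, zpow_ofNat, neg_neg, neg_zero, Int.reduceNeg]
    field_simp
    ring
  · ring

theorem S3_mul_add_S111_mul {w : ℝ} (hq : 0 < q) (hA : A ≠ 0) (hw : w = (q - q⁻¹) ^ 2) :
    S3 q A * (A / q) ^ 6 + S111 q A * (A * q) ^ 6 =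
      (A - A⁻¹) * A ^ 6 * ((w + 1) * A ^ 2 - (w + 2) * (w ^ 2 + 4 * w + 1) +
        (w + 1) * (w ^ 3 + 6 * w ^ 2 + 9 * w + 1) * (A ^ 2)⁻¹) /
          ((q - q⁻¹) ^ 3 * three_q q) := by
  have hq' := hq.ne'
  have h2 := two_q_ne_zero hq
  have h : S3 q A * (A / q) ^ 6 + S111 q A * (A * q) ^ 6 = (A - A⁻¹) * (
      (A * q - A⁻¹ * q⁻¹) * (A * q ^ 2 - A⁻¹ * (q ^ 2)⁻¹) * (A / q) ^ 6 +
      (A * q⁻¹ - A⁻¹ * q) * (A * (q ^ 2)⁻¹ - A⁻¹ * q ^ 2) * (A * q) ^ 6) / two_q q /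
        ((q - q⁻¹) ^ 3 * three_q q) := by
    simp only [S3, S111, shifted_q, zpow_neg, zpow_ofNat, neg_neg, neg_zero, Int.reduceNeg]
    generalize q - q⁻¹ = z, two_q q = t, three_q q = u
    ring
  rw [h]
  congr 1
  rw [div_eq_iff h2, hw, two_q]
  field_simp
  ring

theorem homflyStar_Qhat_neg_one (hq : 0 < q) (hA : A ≠ 0) (n : ℕ) {w a : ℝ}
    (hw : w = (q - q⁻¹) ^ 2) (ha : (w + 3) * a = w + 1 + (Chebyshev.C ℝ n).eval (-1 - w)) :
    homflyStar (Qhat 1 1 n (-1)) q A hq hA =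
      (q - q⁻¹) ^ (-3 : ℤ) * ((A - A⁻¹) * A ^ 6 *
        (a * A ^ 2 - (w + 2) * (w + a) + (a + w * (w + 1) * (w + 3)) * (A ^ 2)⁻¹)) := by
  have hw3 : w + 3 ≠ 0 := by rw [hw]; positivity
  have h3 : ((q / A) ^ 6) ^ (-1 : ℤ) = (A / q) ^ 6 := by rw [zpow_neg_one, ← inv_pow, inv_div]
  have hV : (Chebyshev.C ℝ n).eval (-1 - w) = (w + 3) * a - w - 1 := by linear_combination -ha
  rw [homflyStar_Qhat, h3, zpow_neg_one, zpow_neg_one, inv_inv, inv_inv,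
    S3_mul_add_S111_mul hq hA hw, S21_eq hq.ne' hA, three_q_eq hq.ne', ← hw, hV, zpow_neg,
    zpow_ofNat, div_mul_eq_mul_div, ← add_div, div_eq_mul_inv, mul_inv, mul_comm, mul_assoc]
  congr 1
  rw [inv_mul_eq_iff_eq_mul₀ hw3]
  ring

end Homfly

/-! ### The refined integers -/

theorem sub_inv_ne_zero {q : ℝ} (hq : 0 < q) (hq1 : q ≠ 1) : q - q⁻¹ ≠ 0 := by
  intro h
  obtain hq' | hq' | hq' := (self_eq_inv₀ (a := q)).1 (sub_eq_zero.1 h)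
  · linarith
  · exact hq.ne' hq'
  · exact hq1 hq'

theorem cBox_eq_one {q : ℝ} (hq : 0 < q) (hq1 : q ≠ 1) : cBox q = 1 := by
  simp [cBox, sub_inv_ne_zero hq hq1]

theorem exists_sub_inv_eq {z : ℝ} (hz : z ≠ 0) : ∃ q : ℝ, 0 < q ∧ q ≠ 1 ∧ q - q⁻¹ = z := by
  have hs : √(z ^ 2 + 4) ^ 2 = z ^ 2 + 4 := Real.sq_sqrt (by positivity)
  have hlt : |z| < √(z ^ 2 + 4) := by
    rw [← Real.sqrt_sq_eq_abs]
    exact Real.sqrt_lt_sqrt (sq_nonneg z) (by linarith)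
  have hpos : 0 < z + √(z ^ 2 + 4) := by linarith [neg_abs_le z]
  have hq : (z + √(z ^ 2 + 4)) / 2 - ((z + √(z ^ 2 + 4)) / 2)⁻¹ = z := by
    field_simp
    linear_combination hs
  refine ⟨(z + √(z ^ 2 + 4)) / 2, by positivity, fun h => hz ?_, hq⟩
  simpa [h] using hq.symm

section RefinedEval

variable {K : Type*} [Field K]

/-- The value `∑ N (m, k) A ^ m z ^ (2 k - 1)` of the Laurent polynomial encoded by a family `N` of
refined integers; `z` stands for `q - q⁻¹`. -/
noncomputable def refinedEval (A z : K) : (ℤ × ℤ →₀ ℤ) →ₗ[ℤ] K :=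
  Finsupp.linearCombination ℤ fun p => A ^ p.1 * z ^ (2 * p.2 - 1)

/-- The family `N (j, i - 1) = p.coeff i`, which encodes `A ^ j * z ^ (-3) * p (z ^ 2)`. -/
noncomputable def row (j : ℤ) (p : ℤ[X]) : ℤ × ℤ →₀ ℤ :=
  p.toFinsupp.coeff.mapDomain fun i : ℕ => (j, (i : ℤ) - 1)

theorem row_apply_sub_one (j : ℤ) (p : ℤ[X]) (i : ℕ) : row j p (j, (i : ℤ) - 1) = p.coeff i :=
  Finsupp.mapDomain_apply (fun i i' h => by simpa using h) p.toFinsupp.coeff i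

theorem row_apply_of_ne {j m : ℤ} (hm : m ≠ j) (p : ℤ[X]) (k : ℤ) : row j p (m, k) = 0 :=
  Finsupp.mapDomain_of_notMem_range _ _ (by simp [hm.symm])

theorem row_apply_of_neg (j m : ℤ) {p : ℤ[X]} (hp : p.coeff 0 = 0) {k : ℤ} (hk : k < 0) :
    row j p (m, k) = 0 := by
  by_cases h : (m, k) = (j, ((0 : ℕ) : ℤ) - 1)
  · rw [h, row_apply_sub_one, hp]
  · refine Finsupp.mapDomain_of_notMem_range _ _ ?_
    rintro ⟨i, hi⟩
    obtain ⟨rfl, rfl⟩ := Prod.ext_iff.1 hi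
    obtain rfl : i = 0 := by lia
    exact h rfl

theorem refinedEval_row (A : K) {z : K} (hz : z ≠ 0) (j : ℤ) (p : ℤ[X]) :
    refinedEval A z (row j p) = z ^ (-3 : ℤ) * (aeval (z ^ 2) p * A ^ j) := by
  have hexp (i : ℕ) : z ^ (2 * ((i : ℤ) - 1) - 1) = z ^ (-3 : ℤ) * (z ^ 2) ^ i := by
    rw [show 2 * ((i : ℤ) - 1) - 1 = -3 + ((2 * i : ℕ) : ℤ) by push_cast; ring, zpow_add₀ hz,
      zpow_natCast, pow_mul]
  rw [refinedEval, row, Finsupp.linearCombination_mapDomain, Finsupp.linearCombination_apply,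
    aeval_def, eval₂_eq_sum, Polynomial.sum, Finset.sum_mul, Finset.mul_sum]
  refine Finset.sum_congr rfl fun i _ => ?_
  simp only [Function.comp_apply, hexp, zsmul_eq_mul, eq_intCast, coeff]
  ring

/-- The family of refined integers of the mirror image, which is obtained by
`(q, A) ↦ (q⁻¹, A⁻¹)`. The sign comes from the odd powers of `q - q⁻¹`. -/
noncomputable def mirror (N : ℤ × ℤ →₀ ℤ) : ℤ × ℤ →₀ ℤ :=
  -N.equivMapDomain ((Equiv.neg ℤ).prodCongr (Equiv.refl ℤ))

theorem mirror_apply (N : ℤ × ℤ →₀ ℤ) (m k : ℤ) : mirror N (m, k) = -N (-m, k) := by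
  simp [mirror]

theorem refinedEval_mirror (A z : K) (N : ℤ × ℤ →₀ ℤ) :
    refinedEval A z (mirror N) = refinedEval A⁻¹ (-z) N := by
  have hodd (k : ℤ) : (-z) ^ (2 * k - 1) = -z ^ (2 * k - 1) :=
    Odd.neg_zpow ⟨k - 1, by ring⟩ z
  rw [mirror, map_neg, refinedEval, refinedEval, Finsupp.linearCombination_equivMapDomain]
  simp only [Finsupp.linearCombination_apply, Finsupp.sum, Function.comp_def, hodd,
    ← Finset.sum_neg_distrib]
  simp

end RefinedEval

theorem isRefinedFamily_iff {b : Braid3} {N : ℤ × ℤ →₀ ℤ} :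
    IsRefinedFamily b N ↔ ∀ (q A : ℝ) (hq : 0 < q) (hA : A ≠ 0), q ≠ 1 →
      homflyStar b q A hq hA = refinedEval A (q - q⁻¹) N := by
  refine forall₅_congr fun q A hq hA hq1 => ?_
  rw [cBox_eq_one hq hq1, refinedEval, Finsupp.linearCombination_apply, reformulated]
  simp only [one_mul, zsmul_eq_mul, mul_assoc]

/-- The character `(A, z) ↦ A ^ m * z ^ (2 k - 1)` of `ℝˣ × ℝˣ`, for `p = (m, k)`. -/
def monomialChar (p : ℤ × ℤ) : ℝˣ × ℝˣ →* ℝ :=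
  (Units.coeHom ℝ).comp
    ((zpowGroupHom p.1).comp (MonoidHom.fst ℝˣ ℝˣ) *
      (zpowGroupHom (2 * p.2 - 1)).comp (MonoidHom.snd ℝˣ ℝˣ))

theorem monomialChar_apply (p : ℤ × ℤ) (x : ℝˣ × ℝˣ) :
    monomialChar p x = (x.1 : ℝ) ^ p.1 * (x.2 : ℝ) ^ (2 * p.2 - 1) := by
  simp [monomialChar]

theorem monomialChar_injective : Function.Injective monomialChar := by
  intro p p' h
  have hpow : Function.Injective fun m : ℤ => (2 : ℝ) ^ m :=
    zpow_right_injective₀ two_pos (by norm_num)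
  have hA := DFunLike.congr_fun h (Units.mk0 2 two_ne_zero, 1)
  have hz := DFunLike.congr_fun h (1, Units.mk0 2 two_ne_zero)
  simp only [monomialChar_apply, Units.val_mk0, Units.val_one, one_zpow, mul_one, one_mul] at hA hz
  exact Prod.ext (hpow hA) (by linarith [hpow hz])

theorem linearIndependent_monomialChar :
    LinearIndependent ℤ fun p => (monomialChar p : ℝˣ × ℝˣ → ℝ) :=
  ((linearIndependent_monoidHom (ℝˣ × ℝˣ) ℝ).comp _ monomialChar_injective).restrict_scalars' ℤ

theorem refinedEval_eq_linearCombination (A z : ℝˣ) (N : ℤ × ℤ →₀ ℤ) :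
    refinedEval (A : ℝ) z N =
      Finsupp.linearCombination ℤ (fun p => (monomialChar p : ℝˣ × ℝˣ → ℝ)) N (A, z) := by
  simp [refinedEval, Finsupp.linearCombination_apply, Finsupp.sum, monomialChar_apply]

theorem IsRefinedFamily.unique {b : Braid3} {N N' : ℤ × ℤ →₀ ℤ} (h : IsRefinedFamily b N)
    (h' : IsRefinedFamily b N') : N = N' := by
  apply linearIndependent_monomialChar
  funext ⟨A, z⟩
  obtain ⟨q, hq, hq1, hz⟩ := exists_sub_inv_eq z.ne_zero
  rw [← refinedEval_eq_linearCombination, ← refinedEval_eq_linearCombination, ← hz,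
    ← isRefinedFamily_iff.1 h q A hq A.ne_zero hq1, isRefinedFamily_iff.1 h' q A hq A.ne_zero hq1]

/-- The quotient `(w + 1 + tracePoly n) / (w + 3)`, where `w + 3` is `[3]_q`. -/
noncomputable def threeQuot (n : ℕ) : ℤ[X] := (X + 1 + tracePoly n) /ₘ (X - C (-3))

theorem X_add_three_mul_threeQuot (n : ℕ) : (X + 3) * threeQuot n = X + 1 + tracePoly n := by
  have hroot : (X + 1 + tracePoly n).IsRoot (-3) := by simp [eval_neg_three_tracePoly]
  have hX : (X + 3 : ℤ[X]) = X - C (-3) := by simp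
  rw [hX, threeQuot, mul_divByMonic_eq_iff_isRoot.2 hroot]

theorem coeff_zero_threeQuot_of_not_dvd {n : ℕ} (hn : ¬ 3 ∣ n) : (threeQuot n).coeff 0 = 0 := by
  have h := congrArg (coeff · 0) (X_add_three_mul_threeQuot n)
  simpa [mul_coeff_zero, coeff_zero_tracePoly_of_not_dvd hn] using h

/-- The refined integers of the closure of `(σ₁σ₂⁻¹)^n (σ₁σ₂)^(-3)`, read off from the coefficients
of `A ^ 9`, `A ^ 7`, `A ^ 5`, `A ^ 3` in `homflyStar_Qhat_neg_one`. -/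
noncomputable def refinedFamily (n : ℕ) : ℤ × ℤ →₀ ℤ :=
  row 9 (threeQuot n) + row 7 (-(tracePoly n + (1 + 3 * X + X ^ 2))) +
    row 5 (tracePoly n + (1 + 6 * X + 5 * X ^ 2 + X ^ 3)) +
      row 3 (-(threeQuot n + (3 * X + 4 * X ^ 2 + X ^ 3)))

theorem isRefinedFamily_refinedFamily (n : ℕ) :
    IsRefinedFamily (Qhat 1 1 n (-1)) (refinedFamily n) := by
  refine isRefinedFamily_iff.2 fun q A hq hA hq1 => ?_
  have hz := sub_inv_ne_zero hq hq1
  have ha := congrArg (aeval ((q - q⁻¹) ^ 2)) (X_add_three_mul_threeQuot n)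
  simp only [map_mul, map_add, aeval_X, map_one, map_ofNat] at ha
  have hV := aeval_tracePoly ((q - q⁻¹) ^ 2) n
  rw [homflyStar_Qhat_neg_one hq hA n rfl (ha.trans (by rw [hV])), refinedFamily]
  simp only [map_add, refinedEval_row A hz, map_neg, map_mul, map_pow, aeval_X, map_one, map_ofNat,
    zpow_ofNat, eq_sub_of_add_eq' ha.symm]
  field_simp
  ring

theorem isRefinedFamily_mirror_refinedFamily (n : ℕ) :
    IsRefinedFamily (Qhat 1 1 n 1) (mirror (refinedFamily n)) := by
  refine isRefinedFamily_iff.2 fun q A hq hA hq1 => ?_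
  have h := isRefinedFamily_iff.1 (isRefinedFamily_refinedFamily n) q⁻¹ A⁻¹ (inv_pos.2 hq)
    (inv_ne_zero hA) (inv_ne_one.2 hq1)
  rw [← homflyStar_Qhat_neg hq hA, neg_neg] at h
  rw [h, refinedEval_mirror, inv_inv, neg_sub]

theorem refinedFamily_of_neg {n : ℕ} (hn : ¬ 3 ∣ n) (m : ℤ) {k : ℤ} (hk : k < 0) :
    refinedFamily n (m, k) = 0 := by
  have ht := coeff_zero_tracePoly_of_not_dvd hn
  have ha := coeff_zero_threeQuot_of_not_dvd hn
  simp only [refinedFamily, Finsupp.add_apply]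
  rw [row_apply_of_neg _ _ ha hk, row_apply_of_neg _ _ (by simp [ht]) hk,
    row_apply_of_neg _ _ (by simp [ht]) hk, row_apply_of_neg _ _ (by simp [ha]) hk]
  simp

theorem refinedFamily_five (n k : ℕ) : (refinedFamily n (5, (k : ℤ) - 1) : ℝ) = G n k := by
  have h : refinedFamily n (5, (k : ℤ) - 1) =
      (tracePoly n + (1 + 6 * X + 5 * X ^ 2 + X ^ 3)).coeff k := by
    simp [refinedFamily, row_apply_sub_one, row_apply_of_ne]
  rw [h, G, coeff_add, Int.cast_add, coeff_tracePoly, ← map_ofNat C 6, ← map_ofNat C 5]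
  simp [coeff_one, coeff_X, coeff_X_pow, delta, eq_comm]

theorem refinedFamily_seven {n : ℕ} (hn : n ≠ 0) (k : ℕ) :
    (refinedFamily n (7, (k : ℤ) - 1) : ℝ) = F n k := by
  have h : refinedFamily n (7, (k : ℤ) - 1) = -(tracePoly n + (1 + 3 * X + X ^ 2)).coeff k := by
    simp [refinedFamily, row_apply_sub_one, row_apply_of_ne]
  rw [h, F, coeff_add, Int.cast_neg, Int.cast_add, coeff_tracePoly, ← map_ofNat C 3,
    ← pow_sub_one_mul hn (-1 : ℝ)]
  simp only [coeff_add, coeff_one, coeff_C_mul, coeff_X, coeff_X_pow, Int.cast_add, Int.cast_mul,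
    Int.cast_ite, Int.cast_one, Int.cast_zero, Int.cast_ofNat, delta, eq_comm (b := 0),
    eq_comm (b := 1)]
  ring

end HybridWeaving

open HybridWeaving in
theorem proposition4_general (n : ℕ) (hn : n ≠ 0) :
    (∃! N : ℤ × ℤ →₀ ℤ, IsRefinedFamily (Qhat 1 1 n (-1)) N) ∧
    (∃! N : ℤ × ℤ →₀ ℤ, IsRefinedFamily (Qhat 1 1 n 1) N) ∧
    ∀ Nminus Nplus : ℤ × ℤ →₀ ℤ,
      IsRefinedFamily (Qhat 1 1 n (-1)) Nminus →
      IsRefinedFamily (Qhat 1 1 n 1) Nplus →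
      (¬ 3 ∣ n → ∀ m k : ℤ, k < 0 → Nminus (m, k) = 0 ∧ Nplus (m, k) = 0) ∧
      ∀ k : ℕ,
        (Nminus (5, (k : ℤ) - 1) : ℝ) = G n k ∧
        (Nminus (7, (k : ℤ) - 1) : ℝ) = F n k ∧
        (Nplus (-5, (k : ℤ) - 1) : ℝ) = -G n k ∧
        (Nplus (-7, (k : ℤ) - 1) : ℝ) = -F n k := by
  have hminus := isRefinedFamily_refinedFamily n
  have hplus := isRefinedFamily_mirror_refinedFamily n
  refine ⟨⟨_, hminus, fun N hN => hN.unique hminus⟩, ⟨_, hplus, fun N hN => hN.unique hplus⟩, ?_⟩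
  intro Nminus Nplus hNminus hNplus
  obtain rfl := hNminus.unique hminus
  obtain rfl := hNplus.unique hplus
  refine ⟨fun h3 m k hk => ?_, fun k => ?_⟩
  · simp [mirror_apply, refinedFamily_of_neg h3 _ hk]
  · simp [mirror_apply, refinedFamily_five, refinedFamily_seven hn]

theorem proposition4 (n : ℕ) (hn : 4 ≤ n) :
    (∃! N : ℤ × ℤ →₀ ℤ, HybridWeaving.IsRefinedFamily (HybridWeaving.Qhat 1 1 n (-1)) N) ∧
    (∃! N : ℤ × ℤ →₀ ℤ, HybridWeaving.IsRefinedFamily (HybridWeaving.Qhat 1 1 n 1) N) ∧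
    ∀ Nminus Nplus : ℤ × ℤ →₀ ℤ,
      HybridWeaving.IsRefinedFamily (HybridWeaving.Qhat 1 1 n (-1)) Nminus →
      HybridWeaving.IsRefinedFamily (HybridWeaving.Qhat 1 1 n 1) Nplus →
      (¬ 3 ∣ n → ∀ m k : ℤ, k < 0 → Nminus (m, k) = 0 ∧ Nplus (m, k) = 0) ∧
      ∀ k : ℕ, k ≤ n →
        (Nminus (5, (k : ℤ) - 1) : ℝ) = HybridWeaving.G n k ∧
        (Nminus (7, (k : ℤ) - 1) : ℝ) = HybridWeaving.F n k ∧
        (Nplus (-5, (k : ℤ) - 1) : ℝ) = -HybridWeaving.G n k ∧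
        (Nplus (-7, (k : ℤ) - 1) : ℝ) = -HybridWeaving.F n k := by
  obtain ⟨hminus, hplus, hvalues⟩ := proposition4_general n (by lia)
  exact ⟨hminus, hplus, fun N N' h h' => (hvalues N N' h h').imp_right fun hk k _ => hk k⟩
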